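/- For a positive integer $n$ let $F(n)=\#\{b\in(\mathbb Z/n\mathbb Z)^\times : b^{n-1}=1\}$, let $\varphi$ be Euler's function, and for $n>1$ let $P^+(n)$ denote the largest prime factor of $n$. For composite $n$ put $P=P^+(n)$ and $Q=P^+(n/P)$ (the two largest prime factors of $n$, counted with multiplicity). Let $x,L_1,L,M$ be real numbers with $10<L_1<L<M/2$ and $x>L^2>M$. Then $$\sum_{\substack{n\le x,\ n\text{ odd, composite}\\ P\le L,\ PQ>M\\ F(n)\ge\varphi(n)/L_1}}F(n)\ \le\ x^2C,$$ where $$C=\frac{L^2}{2x}(1+\log L_1)+\frac{2(1+\log L_1)^2}{M\log M}+\frac{1}{12(M-2L)}(1+\log L)(4+\log L_1)^4\Big(\frac{5}{12}+(\zeta(3)-1)(1+\log L)\Big)$$ and $\zeta$ is the Riemann zeta-function. -/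

import Mathlib

/-- The number of residues `b` in `(ℤ/nℤ)ˣ` with `b ^ (n - 1) = 1`. -/
noncomputable def fermatCount (n : ℕ) : ℕ :=
  Nat.card {b : (ZMod n)ˣ // b ^ (n - 1) = 1}

/-- The largest prime factor of `n`, for `n > 1` (the value is `0` for `n ≤ 1`). -/
def largestPrimeFactor (n : ℕ) : ℕ :=
  n.primeFactors.sup id

/-- The second largest prime factor of `n`, counted with multiplicity, for composite `n`. -/
def secondPrimeFactor (n : ℕ) : ℕ :=
  largestPrimeFactor (n / largestPrimeFactor n)

open scoped Classical in
/-- The odd composite `n ≤ x` whose two largest prime factors `P ≥ Q` satisfy `P ≤ L` and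
`P * Q > M`, and for which `F(n) ≥ φ(n) / L₁`. -/
noncomputable def smoothNearCarmichael (x L₁ L M : ℝ) : Finset ℕ :=
  (Finset.Icc 1 ⌊x⌋₊).filter fun n =>
    Odd n ∧ 1 < n ∧ ¬ n.Prime ∧
    (largestPrimeFactor n : ℝ) ≤ L ∧
    M < (largestPrimeFactor n : ℝ) * (secondPrimeFactor n : ℝ) ∧
    (Nat.totient n : ℝ) / L₁ ≤ (fermatCount n : ℝ)

/-- The constant `C`; `ζ(3)` is real and is written as the real part of the complex value. -/
noncomputable def constC (x L₁ L M : ℝ) : ℝ :=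
  L ^ 2 / (2 * x) * (1 + Real.log L₁)
    + 2 * (1 + Real.log L₁) ^ 2 / (M * Real.log M)
    + 1 / (12 * (M - 2 * L)) * (1 + Real.log L) * (4 + Real.log L₁) ^ 4
      * (5 / 12 + ((riemannZeta 3).re - 1) * (1 + Real.log L))

/-! ### Torsion in finite groups and the function `fermatCount` -/

/-! The proportion of residues counted by `fermatCount n` can only grow on passing to a quotient of
`(ZMod n)ˣ`, since a fibre of a homomorphism has at most as many solutions as the kernel has
elements. The sum splits according to whether Q = P.

If Q = P, the quotient modulo P² is cyclic of order P(P-1) with P prime to n-1, so F(n) ≤ φ(n)/P.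
There are at most x/P² such n for each P > √M, and summing x²/P³ gives 2x²/M
(`sum_fermatCount_of_eq_le`).

If Q ≠ P, write P-1 = d₁g₁ and Q-1 = d₂g₂ with gᵢ the gcd with n-1. The quotient modulo PQ gives
F(n) ≤ φ(n)/(d₁d₂), hence d₁d₂ ≤ L₁. For fixed dᵢ, gᵢ, n is 0 modulo PQ and 1 modulo lcm(g₁,g₂), so
at most 1 + x/(PQ lcm(g₁,g₂)) values of n occur (`card_le_of_gcdPair_eq`). The terms 1 are summed
using P > Q; the main terms are summed by `sum_inv_lcm_le`, where (P-1)(Q-1) > M-2L gives the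
saving.

The resulting bound is of a different shape from C, and `bound_le_constC` compares the two. -/

theorem card_pow_eq_one_mul_card_le {G H : Type*} [Group G] [Group H] [Finite G] [Finite H]
    (f : G →* H) (hf : Function.Surjective f) (k : ℕ) :
    Nat.card {g : G // g ^ k = 1} * Nat.card H ≤ Nat.card {h : H // h ^ k = 1} * Nat.card G := by
  have hker : Nat.card f.ker * Nat.card H = Nat.card G := by
    rw [← f.ker.card_mul_index, Subgroup.index_ker, MonoidHom.range_eq_top.mpr hf,
      Subgroup.card_top]
  let s := Function.surjInv hf
  have hs : ∀ h, f (s h) = h := Function.surjInv_eq hf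
  -- A torsion element is recorded by its image and its displacement from a chosen preimage; the
  -- displacement lies in the kernel.
  let φ : {g : G // g ^ k = 1} → {h : H // h ^ k = 1} × f.ker := fun g =>
    (⟨f g.1, by rw [← map_pow, g.2, map_one]⟩,
      ⟨(s (f g.1))⁻¹ * g.1, by rw [MonoidHom.mem_ker, map_mul, map_inv, hs, inv_mul_cancel]⟩)
  have hφ : Function.Injective φ := by
    rintro ⟨a, ha⟩ ⟨b, hb⟩ hab
    simp only [φ, Prod.mk.injEq, Subtype.mk.injEq] at hab
    obtain ⟨h₁, h₂⟩ := hab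
    rw [h₁] at h₂
    exact Subtype.ext (mul_left_cancel h₂)
  have hle := Nat.card_le_card_of_injective φ hφ
  rw [Nat.card_prod] at hle
  calc _ ≤ Nat.card {h : H // h ^ k = 1} * Nat.card f.ker * Nat.card H :=
        Nat.mul_le_mul_right _ hle
    _ = _ := by rw [mul_assoc, hker]

theorem IsCyclic.card_subtype_pow_eq_one_le {H : Type*} [Group H] [Finite H] [IsCyclic H] (k : ℕ) :
    Nat.card {h : H // h ^ k = 1} ≤ k.gcd (Nat.card H) := by
  classical
  have := Fintype.ofFinite H
  have hpos : 0 < k.gcd (Nat.card H) := Nat.gcd_pos_of_pos_right _ Nat.card_pos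
  refine le_trans (le_of_eq ?_) (IsCyclic.card_pow_eq_one_le (α := H) hpos)
  rw [Nat.card_eq_fintype_card, Fintype.card_subtype]
  congr 1
  ext h
  simp [pow_gcd_eq_one]

theorem card_units_zmod (n : ℕ) [NeZero n] : Nat.card (ZMod n)ˣ = n.totient := by
  rw [Nat.card_eq_fintype_card, ZMod.card_units_eq_totient]

theorem exists_surjective_units_prod {n p q : ℕ} [NeZero n] (hpq : p.Coprime q) (hn : p * q ∣ n) :
    ∃ f : (ZMod n)ˣ →* (ZMod p)ˣ × (ZMod q)ˣ, Function.Surjective f := by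
  let e : (ZMod (p * q))ˣ ≃* (ZMod p)ˣ × (ZMod q)ˣ :=
    (Units.mapEquiv (ZMod.chineseRemainder hpq).toMulEquiv).trans MulEquiv.prodUnits
  exact ⟨e.toMonoidHom.comp (ZMod.unitsMap hn),
    e.surjective.comp (ZMod.unitsMap_surjective hn)⟩

/-- Two distinct primes dividing `n` contribute independently to the index of the group counted
by `fermatCount n`. -/
theorem fermatCount_mul_le_totient {n p q : ℕ} (hn : n ≠ 0) (hp : p.Prime) (hq : q.Prime)
    (hpq : p ≠ q) (hpn : p ∣ n) (hqn : q ∣ n) :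
    fermatCount n * (((p - 1) / (n - 1).gcd (p - 1)) * ((q - 1) / (n - 1).gcd (q - 1)))
      ≤ n.totient := by
  have : NeZero n := ⟨hn⟩
  have : Fact p.Prime := ⟨hp⟩
  have : Fact q.Prime := ⟨hq⟩
  have hco : p.Coprime q := (Nat.coprime_primes hp hq).mpr hpq
  obtain ⟨f, hf⟩ := exists_surjective_units_prod hco (hco.mul_dvd_of_dvd_of_dvd hpn hqn)
  have key := card_pow_eq_one_mul_card_le f hf (n - 1)
  have hp1 : Nat.card (ZMod p)ˣ = p - 1 := by rw [card_units_zmod, Nat.totient_prime hp]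
  have hq1 : Nat.card (ZMod q)ˣ = q - 1 := by rw [card_units_zmod, Nat.totient_prime hq]
  have hH : Nat.card {h : (ZMod p)ˣ × (ZMod q)ˣ // h ^ (n - 1) = 1} ≤
      (n - 1).gcd (p - 1) * (n - 1).gcd (q - 1) := by
    let φ : {h : (ZMod p)ˣ × (ZMod q)ˣ // h ^ (n - 1) = 1} →
        {h : (ZMod p)ˣ // h ^ (n - 1) = 1} × {h : (ZMod q)ˣ // h ^ (n - 1) = 1} := fun h =>
      (⟨h.1.1, congrArg Prod.fst h.2⟩, ⟨h.1.2, congrArg Prod.snd h.2⟩)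
    have hφ : Function.Injective φ := by
      rintro ⟨⟨a, b⟩, h⟩ ⟨⟨c, d⟩, h'⟩ hab
      simp only [φ, Prod.mk.injEq, Subtype.mk.injEq] at hab
      exact Subtype.ext (Prod.ext hab.1 hab.2)
    refine (Nat.card_le_card_of_injective φ hφ).trans ?_
    rw [Nat.card_prod]
    refine Nat.mul_le_mul ?_ ?_
    · simpa only [hp1] using IsCyclic.card_subtype_pow_eq_one_le (H := (ZMod p)ˣ) (n - 1)
    · simpa only [hq1] using IsCyclic.card_subtype_pow_eq_one_le (H := (ZMod q)ˣ) (n - 1)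
  rw [Nat.card_prod, hp1, hq1, card_units_zmod n] at key
  have hp0 : 0 < p - 1 := Nat.sub_pos_of_lt hp.one_lt
  have hq0 : 0 < q - 1 := Nat.sub_pos_of_lt hq.one_lt
  set g₁ := (n - 1).gcd (p - 1) with hg₁
  set g₂ := (n - 1).gcd (q - 1) with hg₂
  have hg₁0 : 0 < g₁ := Nat.gcd_pos_of_pos_right _ hp0
  have hg₂0 : 0 < g₂ := Nat.gcd_pos_of_pos_right _ hq0
  have e₁ : (p - 1) / g₁ * g₁ = p - 1 := Nat.div_mul_cancel (Nat.gcd_dvd_right _ _)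
  have e₂ : (q - 1) / g₂ * g₂ = q - 1 := Nat.div_mul_cancel (Nat.gcd_dvd_right _ _)
  refine Nat.le_of_mul_le_mul_left ?_ (Nat.mul_pos hg₁0 hg₂0)
  calc g₁ * g₂ * (fermatCount n * ((p - 1) / g₁ * ((q - 1) / g₂)))
      = fermatCount n * (((p - 1) / g₁ * g₁) * ((q - 1) / g₂ * g₂)) := by ring
    _ = fermatCount n * ((p - 1) * (q - 1)) := by rw [e₁, e₂]
    _ ≤ _ := key.trans (Nat.mul_le_mul_right _ hH)

/-- As p divides n, it is prime to n-1, so the gcd of n-1 with p(p-1) divides p-1: the factor p in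
the order of the cyclic group modulo p² is lost. -/
theorem fermatCount_mul_prime_le_totient {n p : ℕ} (hn : n ≠ 0) (hp : p.Prime) (hp2 : p ≠ 2)
    (hpn : p ^ 2 ∣ n) : fermatCount n * p ≤ n.totient := by
  have : NeZero n := ⟨hn⟩
  have : NeZero (p ^ 2) := ⟨pow_ne_zero 2 hp.ne_zero⟩
  have : IsCyclic (ZMod (p ^ 2))ˣ := ZMod.isCyclic_units_of_prime_pow p hp hp2 2
  have key := card_pow_eq_one_mul_card_le (ZMod.unitsMap hpn) (ZMod.unitsMap_surjective hpn) (n - 1)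
  have hH := IsCyclic.card_subtype_pow_eq_one_le (H := (ZMod (p ^ 2))ˣ) (n - 1)
  have hc : Nat.card (ZMod (p ^ 2))ˣ = p * (p - 1) := by
    rw [card_units_zmod, Nat.totient_prime_pow hp two_pos]; simp
  have hp0 : 0 < p - 1 := Nat.sub_pos_of_lt hp.one_lt
  have hco : (n - 1).Coprime p := by
    refine Nat.Coprime.symm ((Nat.Prime.coprime_iff_not_dvd hp).mpr fun h => ?_)
    have h1 : p ∣ n := (dvd_pow_self p two_ne_zero).trans hpn
    have h2 := (Nat.dvd_sub_iff_right (Nat.one_le_iff_ne_zero.mpr hn) h1).mp h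
    exact hp.one_lt.ne' (Nat.dvd_one.mp h2)
  rw [hc, hco.symm.gcd_mul_left_cancel_right] at hH
  have hH' := hH.trans (Nat.gcd_le_right _ hp0)
  rw [hc, card_units_zmod n] at key
  refine Nat.le_of_mul_le_mul_left ?_ hp0
  calc (p - 1) * (fermatCount n * p) = fermatCount n * (p * (p - 1)) := by ring
    _ ≤ _ := key.trans (Nat.mul_le_mul_right _ hH')

/-! ### The two largest prime factors -/

theorem largestPrimeFactor_mem {n : ℕ} (hn : 1 < n) :
    largestPrimeFactor n ∈ n.primeFactors := by
  obtain ⟨p, hp, h⟩ := Finset.exists_mem_eq_sup n.primeFactors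
    (Nat.nonempty_primeFactors.mpr hn) id
  rw [largestPrimeFactor, h]
  exact hp

theorem le_largestPrimeFactor {n p : ℕ} (hp : p ∈ n.primeFactors) : p ≤ largestPrimeFactor n :=
  Finset.le_sup (f := id) hp

theorem secondPrimeFactor_mem {n : ℕ} (hn : 1 < n) (hc : ¬ n.Prime) :
    secondPrimeFactor n ∈ (n / largestPrimeFactor n).primeFactors := by
  have hP := largestPrimeFactor_mem hn
  have hPp := Nat.prime_of_mem_primeFactors hP
  have hPd := Nat.dvd_of_mem_primeFactors hP
  refine largestPrimeFactor_mem ?_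
  by_contra h
  have hpos : 0 < n / largestPrimeFactor n :=
    Nat.div_pos (Nat.le_of_dvd (by omega) hPd) hPp.pos
  have h1 : n / largestPrimeFactor n = 1 := by omega
  have h2 := Nat.div_mul_cancel hPd
  rw [h1, one_mul] at h2
  exact hc (h2 ▸ hPp)

theorem secondPrimeFactor_le {n : ℕ} (hn : 1 < n) (hc : ¬ n.Prime) :
    secondPrimeFactor n ≤ largestPrimeFactor n := by
  have h := secondPrimeFactor_mem hn hc
  have hPd := Nat.dvd_of_mem_primeFactors (largestPrimeFactor_mem hn)
  exact le_largestPrimeFactor (Nat.primeFactors_mono (Nat.div_dvd_of_dvd hPd) (by omega) h)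

theorem largest_mul_second_dvd {n : ℕ} (hn : 1 < n) (hc : ¬ n.Prime) :
    largestPrimeFactor n * secondPrimeFactor n ∣ n := by
  have hPd := Nat.dvd_of_mem_primeFactors (largestPrimeFactor_mem hn)
  calc _ ∣ largestPrimeFactor n * (n / largestPrimeFactor n) :=
        mul_dvd_mul_left _ (Nat.dvd_of_mem_primeFactors (secondPrimeFactor_mem hn hc))
    _ = n := Nat.mul_div_cancel' hPd

/-! ### Sums over integers -/

theorem sum_inv_sq_gt_le {y : ℝ} (hy : 0 < y) (A : ℕ) :
    ∑ a ∈ (Finset.Icc 1 A).filter (fun a : ℕ => y < (a : ℝ)), ((a : ℝ) ^ 2)⁻¹ ≤ 2 / y := by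
  have hsub : (Finset.Icc 1 A).filter (fun a : ℕ => y < (a : ℝ)) ⊆ Finset.Ioo ⌊y⌋₊ (A + 1) := by
    intro a ha
    simp only [Finset.mem_filter, Finset.mem_Icc, Finset.mem_Ioo] at ha ⊢
    exact ⟨(Nat.floor_lt hy.le).mpr ha.2, by omega⟩
  calc _ ≤ ∑ a ∈ Finset.Ioo ⌊y⌋₊ (A + 1), ((a : ℝ) ^ 2)⁻¹ :=
        Finset.sum_le_sum_of_subset_of_nonneg hsub fun _ _ _ => by positivity
    _ ≤ 2 / ((⌊y⌋₊ : ℝ) + 1) := sum_Ioo_inv_sq_le _ _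
    _ ≤ 2 / y := by
        gcongr
        exact (Nat.lt_floor_add_one y).le

theorem sum_inv_sq_le (A : ℕ) : ∑ a ∈ Finset.Icc 1 A, ((a : ℝ) ^ 2)⁻¹ ≤ 7 / 4 := by
  -- The range is enlarged to A + 2 so that the split at 2 is valid for every A; the terms 1 and 1/4
  -- are kept, and the telescoping tail costs at most 1/2.
  calc ∑ a ∈ Finset.Icc 1 A, ((a : ℝ) ^ 2)⁻¹
      ≤ ∑ a ∈ Finset.Icc 1 2 ∪ Finset.Ioc 2 (A + 2), ((a : ℝ) ^ 2)⁻¹ := by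
        refine Finset.sum_le_sum_of_subset_of_nonneg (fun a ha => ?_) fun _ _ _ => by positivity
        simp only [Finset.mem_Icc, Finset.mem_union, Finset.mem_Ioc] at ha ⊢
        omega
    _ ≤ ∑ a ∈ Finset.Icc (1 : ℕ) 2, ((a : ℝ) ^ 2)⁻¹ + ∑ a ∈ Finset.Ioc 2 (A + 2), ((a : ℝ) ^ 2)⁻¹ := by
        rw [← Finset.sum_union_inter]
        exact le_add_of_nonneg_right (Finset.sum_nonneg fun _ _ => by positivity)
    _ ≤ (1 + 1 / 4) + ((2 : ℕ) : ℝ)⁻¹ := by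
        have h := sum_Ioc_inv_sq_le_sub (α := ℝ) (k := 2) (n := A + 2) two_ne_zero (by omega)
        have h0 : (0 : ℝ) ≤ ((A + 2 : ℕ) : ℝ)⁻¹ := by positivity
        have h1 : ∑ a ∈ Finset.Icc (1 : ℕ) 2, ((a : ℝ) ^ 2)⁻¹ = 1 + 1 / 4 := by
          rw [show Finset.Icc (1 : ℕ) 2 = {1, 2} by decide, Finset.sum_pair (by norm_num)]
          norm_num
        linarith
    _ = 7 / 4 := by norm_num

theorem sum_inv_le_one_add_log {y : ℝ} (hy : 1 ≤ y) :
    ∑ a ∈ Finset.Icc 1 ⌊y⌋₊, ((a : ℝ))⁻¹ ≤ 1 + Real.log y := by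
  have h := harmonic_floor_le_one_add_log y hy
  rw [harmonic_eq_sum_Icc] at h
  push_cast at h
  exact h

/-- The value 1/6 is exactly what the leading coefficient in `bound_le_constC` requires. -/
theorem one_sixth_le_zeta_three_sub_one : 1 / 6 ≤ (riemannZeta 3).re - 1 := by
  have h := zeta_nat_eq_tsum_of_gt_one (k := 3) (by norm_num)
  have hs : Summable fun n : ℕ => 1 / (n : ℝ) ^ 3 :=
    Real.summable_one_div_nat_pow.mpr (by norm_num)
  have h' : riemannZeta 3 = ((∑' n : ℕ, 1 / (n : ℝ) ^ 3 : ℝ) : ℂ) := by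
    rw [show (3 : ℂ) = ((3 : ℕ) : ℂ) by norm_num, h, Complex.ofReal_tsum]
    push_cast
    rfl
  rw [h', Complex.ofReal_re]
  -- The term at 0 is 1/0 = 0. The terms up to 1/64 are needed, since 1/8 + 1/27 < 1/6.
  have := hs.sum_le_tsum (Finset.range 5) fun _ _ => by positivity
  norm_num [Finset.sum_range_succ] at this
  norm_num
  linarith

theorem card_le_div_add_one_of_modEq {s : Finset ℕ} {K X : ℕ} (hX : ∀ n ∈ s, n ≤ X)
    (h : ∀ m ∈ s, ∀ n ∈ s, m ≡ n [MOD K]) : s.card ≤ X / K + 1 := by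
  rw [← Finset.card_range (X / K + 1)]
  refine Finset.card_le_card_of_injOn (fun n => n / K) (fun n hn => ?_) fun m hm n hn hmn => ?_
  · simpa [Nat.lt_succ_iff] using Nat.div_le_div_right (hX n hn)
  · have h1 : m % K = n % K := h m hm n hn
    have h2 : m / K = n / K := hmn
    rw [← Nat.div_add_mod m K, ← Nat.div_add_mod n K, h1, h2]

/-! ### Sums over pairs of factorizations -/

/-- The pairs `(d, g)` with `d ≤ D` and `d * g ≤ E`. -/
def factorPairs (D E : ℕ) : Finset (ℕ × ℕ) :=
  (Finset.Icc 1 D ×ˢ Finset.Icc 1 E).filter fun t => t.1 * t.2 ≤ E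

/-- Each d admits at most E/d values of g, so the sum is at most E times the sum of 1/d². -/
theorem sum_inv_fst_factorPairs_le (D E : ℕ) :
    ∑ t ∈ factorPairs D E, (t.1 : ℝ)⁻¹ ≤ 7 / 4 * E := by
  rw [factorPairs, Finset.sum_filter, Finset.sum_product]
  calc _ ≤ ∑ d ∈ Finset.Icc 1 D, ((d : ℝ) ^ 2)⁻¹ * E := by
        refine Finset.sum_le_sum fun d hd => ?_
        have hd0 : 0 < d := (Finset.mem_Icc.mp hd).1
        have hd1 : (0 : ℝ) < d := by exact_mod_cast hd0
        rw [← Finset.sum_filter]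
        dsimp only
        rw [Finset.sum_const, nsmul_eq_mul]
        have hsub : (Finset.Icc 1 E).filter (fun g => d * g ≤ E) ⊆ Finset.Icc 1 (E / d) := by
          intro g hg
          simp only [Finset.mem_filter, Finset.mem_Icc] at hg ⊢
          exact ⟨hg.1.1, (Nat.le_div_iff_mul_le hd0).mpr (by rw [mul_comm]; exact hg.2)⟩
        have hcard : (((Finset.Icc 1 E).filter (fun g => d * g ≤ E)).card : ℝ) ≤ (E : ℝ) / d := by
          have h := Finset.card_le_card hsub
          rw [Nat.card_Icc, Nat.add_sub_cancel] at h
          exact (Nat.cast_le.mpr h).trans Nat.cast_div_le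
        calc _ ≤ (E : ℝ) / d * (d : ℝ)⁻¹ := by gcongr
          _ = _ := by field_simp
    _ = (∑ d ∈ Finset.Icc 1 D, ((d : ℝ) ^ 2)⁻¹) * E := by rw [Finset.sum_mul]
    _ ≤ _ := by
        gcongr
        exact sum_inv_sq_le D

/-- Swapping coordinates exchanges two disjoint halves of the square. The factor 1/2 matters:
without it, the comparison in `bound_le_constC` would need log L₁ ≥ 41/8. -/
theorem sum_lt_pairs_le_half_sq {α : Type*} (s : Finset α) (f : α → ℕ) (w : α → ℝ)
    (hw : ∀ a, 0 ≤ w a) :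
    ∑ z ∈ (s ×ˢ s).filter (fun z => f z.2 < f z.1), w z.1 * w z.2 ≤ (∑ a ∈ s, w a) ^ 2 / 2 := by
  classical
  have hswap : ∑ z ∈ (s ×ˢ s).filter (fun z => f z.1 < f z.2), w z.1 * w z.2 =
      ∑ z ∈ (s ×ˢ s).filter (fun z => f z.2 < f z.1), w z.1 * w z.2 := by
    refine Finset.sum_nbij' Prod.swap Prod.swap ?_ ?_ ?_ ?_ ?_
    · rintro ⟨a, b⟩ h; simp at h ⊢; tauto
    · rintro ⟨a, b⟩ h; simp at h ⊢; tauto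
    · simp
    · simp
    · rintro ⟨a, b⟩ _; exact mul_comm _ _
  have hdisj : Disjoint ((s ×ˢ s).filter (fun z => f z.2 < f z.1))
      ((s ×ˢ s).filter (fun z => f z.1 < f z.2)) := by
    rw [Finset.disjoint_filter]
    intro z _ h
    omega
  have hle : ∑ z ∈ (s ×ˢ s).filter (fun z => f z.2 < f z.1) ∪
      (s ×ˢ s).filter (fun z => f z.1 < f z.2), w z.1 * w z.2 ≤ ∑ z ∈ s ×ˢ s, w z.1 * w z.2 :=
    Finset.sum_le_sum_of_subset_of_nonneg
      (Finset.union_subset (Finset.filter_subset _ _) (Finset.filter_subset _ _))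
      fun z _ _ => mul_nonneg (hw _) (hw _)
  rw [Finset.sum_union hdisj, hswap, Finset.sum_product, ← Finset.sum_mul_sum] at hle
  linarith [sq (∑ a ∈ s, w a)]

/-- Put g₁ = ua and g₂ = ub with u their gcd. The summand becomes 1/(d₁²d₂²u³a²b²), and a >
N/(d₁d₂u²b). Summing over a first gives at most 2d₁d₂u²b/N, which leaves (2/N)/(d₁d₂ub), a product
of four harmonic sums. -/
theorem sum_inv_lcm_le {D E : ℕ} {N : ℝ} (hN : 0 < N) (B : Finset ((ℕ × ℕ) × (ℕ × ℕ)))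
    (hB : B ⊆ factorPairs D E ×ˢ factorPairs D E)
    (hBN : ∀ z ∈ B, N < ((z.1.1 * z.1.2 * (z.2.1 * z.2.2) : ℕ) : ℝ)) :
    ∑ z ∈ B, ((z.1.1 : ℝ) ^ 2 * (z.2.1 : ℝ) ^ 2 * (z.1.2 * z.2.2) * (z.1.2.lcm z.2.2 : ℕ))⁻¹ ≤
      2 / N * (∑ d ∈ Finset.Icc 1 D, (d : ℝ)⁻¹) ^ 2 * (∑ g ∈ Finset.Icc 1 E, (g : ℝ)⁻¹) ^ 2 := by
  classical
  let V : Finset (ℕ × ℕ × ℕ × ℕ) :=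
    Finset.Icc 1 D ×ˢ Finset.Icc 1 D ×ˢ Finset.Icc 1 E ×ˢ Finset.Icc 1 E
  let c : ℕ × ℕ × ℕ × ℕ → ℝ := fun v => v.1 * v.2.1 * (v.2.2.1 : ℝ) ^ 2 * v.2.2.2
  let h : (ℕ × ℕ × ℕ × ℕ) × ℕ → ℝ := fun y =>
    ((y.1.1 : ℝ) ^ 2 * (y.1.2.1 : ℝ) ^ 2 * (y.1.2.2.1 : ℝ) ^ 3 * (y.1.2.2.2 : ℝ) ^ 2)⁻¹ *
      ((y.2 : ℝ) ^ 2)⁻¹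
  -- The new coordinates are ((d₁, d₂, u, b), a); coprimality of a and b is not retained, as only
  -- injectivity is used.
  let i : (ℕ × ℕ) × (ℕ × ℕ) → (ℕ × ℕ × ℕ × ℕ) × ℕ := fun z =>
    ((z.1.1, z.2.1, z.1.2.gcd z.2.2, z.2.2 / z.1.2.gcd z.2.2), z.1.2 / z.1.2.gcd z.2.2)
  have hdata : ∀ z ∈ B, (1 ≤ z.1.1 ∧ z.1.1 ≤ D) ∧ (1 ≤ z.1.2 ∧ z.1.2 ≤ E) ∧
      (1 ≤ z.2.1 ∧ z.2.1 ≤ D) ∧ (1 ≤ z.2.2 ∧ z.2.2 ≤ E) := by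
    intro z hz
    have := hB hz
    simp only [factorPairs, Finset.mem_product, Finset.mem_filter, Finset.mem_Icc] at this
    tauto
  have hi : Set.InjOn i B := by
    rintro ⟨⟨d₁, g₁⟩, ⟨d₂, g₂⟩⟩ _ ⟨⟨e₁, k₁⟩, ⟨e₂, k₂⟩⟩ _ hzz
    simp only [i, Prod.mk.injEq] at hzz
    obtain ⟨⟨rfl, rfl, hu, hb⟩, ha⟩ := hzz
    have h1 := Nat.div_mul_cancel (Nat.gcd_dvd_left g₁ g₂)
    have h2 := Nat.div_mul_cancel (Nat.gcd_dvd_right g₁ g₂)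
    rw [ha, hu, Nat.div_mul_cancel (Nat.gcd_dvd_left k₁ k₂)] at h1
    rw [hb, hu, Nat.div_mul_cancel (Nat.gcd_dvd_right k₁ k₂)] at h2
    rw [h1, h2]
  have hfac : ∀ z ∈ B, (z.1.2 : ℝ) = (i z).1.2.2.1 * (i z).2 ∧
      (z.2.2 : ℝ) = (i z).1.2.2.1 * (i z).1.2.2.2 ∧
      ((z.1.2.lcm z.2.2 : ℕ) : ℝ) = (i z).1.2.2.1 * (i z).2 * (i z).1.2.2.2 := by
    intro z _
    have e1 : z.1.2 = (i z).1.2.2.1 * (i z).2 := (Nat.mul_div_cancel' (Nat.gcd_dvd_left _ _)).symm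
    have e2 : z.2.2 = (i z).1.2.2.1 * (i z).1.2.2.2 :=
      (Nat.mul_div_cancel' (Nat.gcd_dvd_right _ _)).symm
    have e3 : z.1.2.lcm z.2.2 = (i z).1.2.2.1 * (i z).2 * (i z).1.2.2.2 := by
      rw [← e1]
      exact Nat.mul_div_assoc _ (Nat.gcd_dvd_right _ _)
    exact ⟨by exact_mod_cast e1, by exact_mod_cast e2, by exact_mod_cast e3⟩
  have himg : B.image i ⊆ (V ×ˢ Finset.Icc 1 E).filter (fun y => N / c y.1 < (y.2 : ℝ)) := by
    intro y hy
    obtain ⟨z, hz, rfl⟩ := Finset.mem_image.mp hy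
    obtain ⟨hd1, hg1, hd2, hg2⟩ := hdata z hz
    have hu : 0 < z.1.2.gcd z.2.2 := Nat.gcd_pos_of_pos_left _ hg1.1
    have hbox : i z ∈ V ×ˢ Finset.Icc 1 E := by
      simp only [V, i, Finset.mem_product, Finset.mem_Icc]
      refine ⟨⟨hd1, hd2, ⟨hu, (Nat.gcd_le_left _ hg1.1).trans hg1.2⟩,
        Nat.div_pos (Nat.gcd_le_right _ hg2.1) hu, (Nat.div_le_self _ _).trans hg2.2⟩,
        Nat.div_pos (Nat.gcd_le_left _ hg1.1) hu, (Nat.div_le_self _ _).trans hg1.2⟩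
    refine Finset.mem_filter.mpr ⟨hbox, ?_⟩
    have hc : 0 < c (i z).1 := by
      simp only [V, Finset.mem_product, Finset.mem_Icc] at hbox
      obtain ⟨⟨h1, h2, h3, h4⟩, h5⟩ := hbox
      have h1' : (0 : ℝ) < (i z).1.1 := by exact_mod_cast h1.1
      have h2' : (0 : ℝ) < (i z).1.2.1 := by exact_mod_cast h2.1
      have h3' : (0 : ℝ) < (i z).1.2.2.1 := by exact_mod_cast h3.1
      have h4' : (0 : ℝ) < (i z).1.2.2.2 := by exact_mod_cast h4.1
      positivity
    rw [div_lt_iff₀ hc]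
    refine (hBN z hz).trans_eq ?_
    obtain ⟨e1, e2, -⟩ := hfac z hz
    push_cast
    rw [e1, e2]
    simp only [c, i]
    ring
  calc _ = ∑ z ∈ B, h (i z) := by
        refine Finset.sum_congr rfl fun z hz => ?_
        obtain ⟨e1, e2, e3⟩ := hfac z hz
        rw [e3, e1, e2]
        simp only [h, i]
        rw [← mul_inv]
        congr 1
        ring
    _ = ∑ y ∈ B.image i, h y := (Finset.sum_image hi).symm
    _ ≤ ∑ y ∈ (V ×ˢ Finset.Icc 1 E).filter (fun y => N / c y.1 < (y.2 : ℝ)), h y :=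
        Finset.sum_le_sum_of_subset_of_nonneg himg fun _ _ _ => by positivity
    _ ≤ ∑ v ∈ V, 2 / N * ((v.1 : ℝ)⁻¹ * ((v.2.1 : ℝ)⁻¹ * ((v.2.2.1 : ℝ)⁻¹ * (v.2.2.2 : ℝ)⁻¹))) := by
        rw [Finset.sum_filter, Finset.sum_product]
        refine Finset.sum_le_sum fun v hv => ?_
        simp only [V, Finset.mem_product, Finset.mem_Icc] at hv
        obtain ⟨h1, h2, h3, h4⟩ := hv
        have h1' : (0 : ℝ) < v.1 := by exact_mod_cast h1.1
        have h2' : (0 : ℝ) < v.2.1 := by exact_mod_cast h2.1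
        have h3' : (0 : ℝ) < v.2.2.1 := by exact_mod_cast h3.1
        have h4' : (0 : ℝ) < v.2.2.2 := by exact_mod_cast h4.1
        have hc : 0 < c v := by positivity
        rw [← Finset.sum_filter]
        simp only [h]
        rw [← Finset.mul_sum]
        calc _ ≤ ((v.1 : ℝ) ^ 2 * (v.2.1 : ℝ) ^ 2 * (v.2.2.1 : ℝ) ^ 3 * (v.2.2.2 : ℝ) ^ 2)⁻¹ *
              (2 / (N / c v)) := by
              gcongr
              exact sum_inv_sq_gt_le (div_pos hN hc) E
          _ = _ := by
              simp only [c]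
              field_simp
    _ = _ := by
        rw [← Finset.mul_sum]
        simp only [V, Finset.sum_product, ← Finset.mul_sum, ← Finset.sum_mul]
        ring

/-! ### The two ranges of the sum -/

theorem mem_smoothNearCarmichael {x L₁ L M : ℝ} {n : ℕ} :
    n ∈ smoothNearCarmichael x L₁ L M ↔ (1 ≤ n ∧ n ≤ ⌊x⌋₊) ∧ Odd n ∧ 1 < n ∧ ¬ n.Prime ∧
      (largestPrimeFactor n : ℝ) ≤ L ∧
      M < (largestPrimeFactor n : ℝ) * (secondPrimeFactor n : ℝ) ∧
      (Nat.totient n : ℝ) / L₁ ≤ (fermatCount n : ℝ) := by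
  simp [smoothNearCarmichael]

theorem sum_fermatCount_of_eq_le {x L₁ L M : ℝ} (hx : 0 ≤ x) (hM : 0 < M) :
    ∑ n ∈ (smoothNearCarmichael x L₁ L M).filter
      (fun n => secondPrimeFactor n = largestPrimeFactor n), (fermatCount n : ℝ) ≤
      x ^ 2 * (2 / M) := by
  set S := (smoothNearCarmichael x L₁ L M).filter
      (fun n => secondPrimeFactor n = largestPrimeFactor n) with hS
  set T := (Finset.Icc 1 ⌊L⌋₊).filter (fun p : ℕ => √M < (p : ℝ)) with hT
  have hdata : ∀ n ∈ S, (1 ≤ n ∧ n ≤ ⌊x⌋₊) ∧ largestPrimeFactor n ∈ T ∧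
      largestPrimeFactor n ^ 2 ∣ n ∧ (fermatCount n : ℝ) ≤ x / largestPrimeFactor n := by
    intro n hn
    obtain ⟨hn, hPQ⟩ := Finset.mem_filter.mp hn
    obtain ⟨hnx, hodd, hn1, hnp, hPL, hMP, -⟩ := mem_smoothNearCarmichael.mp hn
    have hP := Nat.prime_of_mem_primeFactors (largestPrimeFactor_mem hn1)
    have hdvd := largest_mul_second_dvd hn1 hnp
    rw [hPQ, ← sq] at hdvd
    rw [hPQ, ← sq] at hMP
    have hP2 : largestPrimeFactor n ≠ 2 := by
      intro h
      rw [h] at hdvd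
      exact (Nat.not_even_iff_odd.mpr hodd)
        (even_iff_two_dvd.mpr ((dvd_pow_self 2 two_ne_zero).trans hdvd))
    refine ⟨hnx, ?_, hdvd, ?_⟩
    · exact Finset.mem_filter.mpr ⟨Finset.mem_Icc.mpr ⟨hP.one_le, Nat.le_floor hPL⟩,
        Real.sqrt_lt' (by exact_mod_cast hP.pos) |>.mpr hMP⟩
    · have hP0 : (0 : ℝ) < largestPrimeFactor n := by exact_mod_cast hP.pos
      rw [le_div_iff₀ hP0]
      have h1 := fermatCount_mul_prime_le_totient (by omega) hP hP2 hdvd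
      calc (fermatCount n : ℝ) * largestPrimeFactor n ≤ n.totient := by exact_mod_cast h1
        _ ≤ n := by exact_mod_cast Nat.totient_le n
        _ ≤ x := (Nat.le_floor_iff hx).mp hnx.2
  have hsM : 0 < √M := Real.sqrt_pos.mpr hM
  calc ∑ n ∈ S, (fermatCount n : ℝ) ≤ ∑ n ∈ S, x / largestPrimeFactor n :=
        Finset.sum_le_sum fun n hn => (hdata n hn).2.2.2
    _ = ∑ p ∈ T, ∑ n ∈ S with largestPrimeFactor n = p, x / largestPrimeFactor n :=
        (Finset.sum_fiberwise_of_maps_to (fun n hn => (hdata n hn).2.1) _).symm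
    _ ≤ ∑ p ∈ T, x ^ 2 / √M * ((p : ℝ) ^ 2)⁻¹ := by
        refine Finset.sum_le_sum fun p hp => ?_
        obtain ⟨hp1, hp2⟩ := Finset.mem_filter.mp hp
        have hp0 : 0 < p := (Finset.mem_Icc.mp hp1).1
        have hp0' : (0 : ℝ) < p := by exact_mod_cast hp0
        have hsub : (S.filter fun n => largestPrimeFactor n = p) ⊆
            (Finset.Ioc 0 ⌊x⌋₊).filter (fun n => p ^ 2 ∣ n) := by
          intro n hn
          obtain ⟨hnS, rfl⟩ := Finset.mem_filter.mp hn
          obtain ⟨h1, -, h2, -⟩ := hdata n hnS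
          exact Finset.mem_filter.mpr ⟨Finset.mem_Ioc.mpr h1, h2⟩
        have hcard : ((S.filter fun n => largestPrimeFactor n = p).card : ℝ) ≤ x / (p : ℝ) ^ 2 := by
          have h := Finset.card_le_card hsub
          rw [Nat.Ioc_filter_dvd_card_eq_div] at h
          calc _ ≤ ((⌊x⌋₊ / p ^ 2 : ℕ) : ℝ) := by exact_mod_cast h
            _ ≤ (⌊x⌋₊ : ℝ) / ((p ^ 2 : ℕ) : ℝ) := Nat.cast_div_le
            _ ≤ x / (p : ℝ) ^ 2 := by
                push_cast
                gcongr
                exact Nat.floor_le hx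
        calc _ = ∑ n ∈ S with largestPrimeFactor n = p, x / (p : ℝ) := by
              refine Finset.sum_congr rfl fun n hn => ?_
              rw [(Finset.mem_filter.mp hn).2]
          _ = ((S.filter fun n => largestPrimeFactor n = p).card : ℝ) * (x / p) := by
              rw [Finset.sum_const, nsmul_eq_mul]
          -- One factor 1/p is spent on p > √M; the other two are kept for the convergent sum.
          _ ≤ x / (p : ℝ) ^ 2 * (x / √M) := by gcongr
          _ = _ := by field_simp
    _ = x ^ 2 / √M * ∑ p ∈ T, ((p : ℝ) ^ 2)⁻¹ := by rw [Finset.mul_sum]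
    _ ≤ x ^ 2 / √M * (2 / √M) := by
        gcongr
        exact sum_inv_sq_gt_le hsM _
    _ = x ^ 2 * (2 / M) := by
        rw [div_mul_div_comm, Real.mul_self_sqrt hM.le, mul_div_assoc]

/-- The pair `((p - 1) / g, g)` with `g = gcd (n - 1, p - 1)`. -/
def gcdPair (n p : ℕ) : ℕ × ℕ :=
  ((p - 1) / (n - 1).gcd (p - 1), (n - 1).gcd (p - 1))

theorem gcdPair_mul {n p : ℕ} : (gcdPair n p).1 * (gcdPair n p).2 = p - 1 :=
  Nat.div_mul_cancel (Nat.gcd_dvd_right _ _)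

theorem gcdPair_mem_factorPairs {n p D E : ℕ} (hp : p.Prime) (hE : p ≤ E)
    (hD : (gcdPair n p).1 ≤ D) : gcdPair n p ∈ factorPairs D E := by
  have hp0 : 0 < p - 1 := Nat.sub_pos_of_lt hp.one_lt
  have hg : 0 < (gcdPair n p).2 := Nat.gcd_pos_of_pos_right _ hp0
  have hd : 0 < (gcdPair n p).1 :=
    Nat.div_pos (Nat.gcd_le_right _ hp0) hg
  have hgp : (gcdPair n p).2 ≤ p - 1 := Nat.gcd_le_right _ hp0
  simp only [factorPairs, Finset.mem_filter, Finset.mem_product, Finset.mem_Icc, gcdPair_mul]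
  omega

/-- The pairs determine both primes p and q. Each n is divisible by pq while n-1 is divisible by the
lcm, so these moduli are coprime and n lies in a single class modulo their product. -/
theorem card_le_of_gcdPair_eq {x : ℝ} (hx : 0 ≤ x) {s : Finset ℕ} (P Q : ℕ → ℕ)
    (z : (ℕ × ℕ) × (ℕ × ℕ))
    (hs : ∀ n ∈ s, (1 ≤ n ∧ n ≤ ⌊x⌋₊) ∧ (P n).Prime ∧ (Q n).Prime ∧ P n * Q n ∣ n ∧
      (gcdPair n (P n), gcdPair n (Q n)) = z) :
    (s.card : ℝ) ≤
      1 + x * (((1 + z.1.1 * z.1.2) * (1 + z.2.1 * z.2.2) * z.1.2.lcm z.2.2 : ℕ) : ℝ)⁻¹ := by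
  set p := 1 + z.1.1 * z.1.2 with hp
  set q := 1 + z.2.1 * z.2.2 with hq
  set l := z.1.2.lcm z.2.2 with hl
  have hmod : ∀ n ∈ s, p * q ∣ n ∧ l ∣ n - 1 := by
    intro n hn
    obtain ⟨hnx, hP, hQ, hd, rfl⟩ := hs n hn
    have hpP : p = P n := by
      rw [hp, gcdPair_mul]
      have := hP.one_lt
      omega
    have hqQ : q = Q n := by
      rw [hq, gcdPair_mul]
      have := hQ.one_lt
      omega
    exact ⟨by rw [hpP, hqQ]; exact hd,
      Nat.lcm_dvd (Nat.gcd_dvd_left _ _) (Nat.gcd_dvd_left _ _)⟩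
  have hcong : ∀ m ∈ s, ∀ n ∈ s, m ≡ n [MOD p * q * l] := by
    intro m hm n hn
    have hm1 := (hs m hm).1.1
    have hn1 := (hs n hn).1.1
    obtain ⟨a1, a2⟩ := hmod m hm
    obtain ⟨b1, b2⟩ := hmod n hn
    have hco : (p * q).Coprime l := by
      refine Nat.Coprime.coprime_dvd_left a1 (Nat.Coprime.coprime_dvd_right a2 ?_)
      exact (Nat.coprime_self_sub_right hm1).mpr (Nat.coprime_one_right m)
    refine (Nat.modEq_and_modEq_iff_modEq_mul hco).mp ⟨?_, ?_⟩
    · exact (Nat.modEq_zero_iff_dvd.mpr a1).trans (Nat.modEq_zero_iff_dvd.mpr b1).symm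
    · exact ((Nat.modEq_iff_dvd' hm1).mpr a2).symm.trans ((Nat.modEq_iff_dvd' hn1).mpr b2)
  have h := card_le_div_add_one_of_modEq (fun n hn => (hs n hn).1.2) hcong
  calc (s.card : ℝ) ≤ ((⌊x⌋₊ / (p * q * l) : ℕ) : ℝ) + 1 := by exact_mod_cast h
    _ ≤ (⌊x⌋₊ : ℝ) / ((p * q * l : ℕ) : ℝ) + 1 := by gcongr; exact Nat.cast_div_le
    _ ≤ x / ((p * q * l : ℕ) : ℝ) + 1 := by gcongr; exact Nat.floor_le hx
    _ = _ := by rw [div_eq_mul_inv, add_comm]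

theorem sum_fermatCount_of_ne_le {x L₁ L M : ℝ} (hx : 0 ≤ x) (hL₁ : 1 ≤ L₁) (hL : 1 ≤ L)
    (hM : 2 * L < M) :
    ∑ n ∈ (smoothNearCarmichael x L₁ L M).filter
      (fun n => ¬ secondPrimeFactor n = largestPrimeFactor n), (fermatCount n : ℝ) ≤
      x * ((7 / 4 * L) ^ 2 / 2) +
        x ^ 2 * (2 / (M - 2 * L) * (1 + Real.log L₁) ^ 2 * (1 + Real.log L) ^ 2) := by
  classical
  set S := (smoothNearCarmichael x L₁ L M).filter
      (fun n => ¬ secondPrimeFactor n = largestPrimeFactor n) with hS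
  set F := factorPairs ⌊L₁⌋₊ ⌊L⌋₊ with hF
  set A := (F ×ˢ F).filter (fun z => z.2.1 * z.2.2 < z.1.1 * z.1.2) with hA
  set B := A.filter (fun z : (ℕ × ℕ) × (ℕ × ℕ) =>
    M - 2 * L < ((z.1.1 * z.1.2 * (z.2.1 * z.2.2) : ℕ) : ℝ)) with hB
  let t : ℕ → (ℕ × ℕ) × (ℕ × ℕ) := fun n =>
    (gcdPair n (largestPrimeFactor n), gcdPair n (secondPrimeFactor n))
  let w : (ℕ × ℕ) × (ℕ × ℕ) → ℝ := fun z => (z.1.1 : ℝ)⁻¹ * (z.2.1 : ℝ)⁻¹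
  have hdata : ∀ n ∈ S, (1 ≤ n ∧ n ≤ ⌊x⌋₊) ∧ (largestPrimeFactor n).Prime ∧
      (secondPrimeFactor n).Prime ∧ largestPrimeFactor n * secondPrimeFactor n ∣ n ∧
      t n ∈ B ∧ (fermatCount n : ℝ) ≤ x * w (t n) := by
    intro n hn
    obtain ⟨hn, hPQ⟩ := Finset.mem_filter.mp hn
    obtain ⟨hnx, -, hn1, hnp, hPL, hMP, hF₁⟩ := mem_smoothNearCarmichael.mp hn
    have hP := Nat.prime_of_mem_primeFactors (largestPrimeFactor_mem hn1)
    have hQ := Nat.prime_of_mem_primeFactors (secondPrimeFactor_mem hn1 hnp)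
    have hdvd := largest_mul_second_dvd hn1 hnp
    have hQP := secondPrimeFactor_le hn1 hnp
    have key := fermatCount_mul_le_totient (n := n) (by omega) hP hQ (Ne.symm hPQ)
      (dvd_of_mul_right_dvd hdvd) (dvd_of_mul_left_dvd hdvd)
    have hP1 : 0 < largestPrimeFactor n - 1 := Nat.sub_pos_of_lt hP.one_lt
    have hQ1 : 0 < secondPrimeFactor n - 1 := Nat.sub_pos_of_lt hQ.one_lt
    have hd₁ : 0 < (t n).1.1 := by
      refine Nat.pos_of_ne_zero fun h => ?_
      have := gcdPair_mul (n := n) (p := largestPrimeFactor n)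
      rw [show (gcdPair n (largestPrimeFactor n)).1 = 0 from h] at this
      omega
    have hd₂ : 0 < (t n).2.1 := by
      refine Nat.pos_of_ne_zero fun h => ?_
      have := gcdPair_mul (n := n) (p := secondPrimeFactor n)
      rw [show (gcdPair n (secondPrimeFactor n)).1 = 0 from h] at this
      omega
    have key' : (fermatCount n : ℝ) * ((t n).1.1 * (t n).2.1) ≤ n.totient := by exact_mod_cast key
    have hd₁' : (0 : ℝ) < (t n).1.1 := by exact_mod_cast hd₁
    have hd₂' : (0 : ℝ) < (t n).2.1 := by exact_mod_cast hd₂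
    have hφ : (0 : ℝ) < n.totient := by exact_mod_cast Nat.totient_pos.mpr (by omega)
    have hL0 : 0 < L₁ := by linarith
    -- This is where the lower bound on F(n) enters; afterwards only the consequence that each dᵢ is
    -- at most L₁ is used.
    have hdd : ((t n).1.1 : ℝ) * (t n).2.1 ≤ L₁ := by
      have h1 : (n.totient : ℝ) / L₁ * ((t n).1.1 * (t n).2.1) ≤ n.totient :=
        (mul_le_mul_of_nonneg_right hF₁ (by positivity)).trans key'
      rw [div_mul_eq_mul_div, div_le_iff₀ hL0] at h1
      exact le_of_mul_le_mul_left h1 hφ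
    have hdd' : (t n).1.1 * (t n).2.1 ≤ ⌊L₁⌋₊ := Nat.le_floor (by exact_mod_cast hdd)
    have hPE : largestPrimeFactor n ≤ ⌊L⌋₊ := Nat.le_floor hPL
    refine ⟨hnx, hP, hQ, hdvd, ?_, ?_⟩
    · refine Finset.mem_filter.mpr ⟨Finset.mem_filter.mpr ⟨Finset.mem_product.mpr ⟨?_, ?_⟩, ?_⟩, ?_⟩
      · exact gcdPair_mem_factorPairs hP hPE ((Nat.le_mul_of_pos_right _ hd₂).trans hdd')
      · exact gcdPair_mem_factorPairs hQ (hQP.trans hPE)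
          ((Nat.le_mul_of_pos_left _ hd₁).trans hdd')
      · simp only [t, gcdPair_mul]
        omega
      · simp only [t, gcdPair_mul]
        have hQL : (secondPrimeFactor n : ℝ) ≤ L := (Nat.cast_le.mpr hQP).trans hPL
        rw [Nat.cast_mul, Nat.cast_sub hP.one_le, Nat.cast_sub hQ.one_le, Nat.cast_one]
        -- (P-1)(Q-1) = PQ - P - Q + 1 > M - 2L.
        linarith
    · simp only [w]
      rw [← mul_inv, ← div_eq_mul_inv, le_div_iff₀ (by positivity)]
      calc _ ≤ (n.totient : ℝ) := key'
        _ ≤ n := by exact_mod_cast Nat.totient_le n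
        _ ≤ x := (Nat.le_floor_iff hx).mp hnx.2
  have hN : 0 < M - 2 * L := by linarith
  have hw : ∀ z, 0 ≤ w z := fun z => by positivity
  have hBA : B ⊆ A := Finset.filter_subset _ _
  have hAF : A ⊆ F ×ˢ F := Finset.filter_subset _ _
  have hdiag : ∑ z ∈ B, w z ≤ (7 / 4 * L) ^ 2 / 2 := by
    calc ∑ z ∈ B, w z ≤ ∑ z ∈ A, w z :=
          Finset.sum_le_sum_of_subset_of_nonneg hBA fun z _ _ => hw z
      _ ≤ (∑ a ∈ F, (a.1 : ℝ)⁻¹) ^ 2 / 2 :=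
          sum_lt_pairs_le_half_sq F (fun a => a.1 * a.2) (fun a => (a.1 : ℝ)⁻¹)
            fun a => by positivity
      _ ≤ (7 / 4 * L) ^ 2 / 2 := by
          have h0 : (0 : ℝ) ≤ ∑ a ∈ F, (a.1 : ℝ)⁻¹ := Finset.sum_nonneg fun _ _ => by positivity
          gcongr
          refine (sum_inv_fst_factorPairs_le _ _).trans ?_
          gcongr
          exact Nat.floor_le (by linarith)
  have hpos : ∀ z ∈ B, 0 < z.1.1 ∧ 0 < z.1.2 ∧ 0 < z.2.1 ∧ 0 < z.2.2 := by
    intro z hz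
    have h := hAF (hBA hz)
    simp only [hF, factorPairs, Finset.mem_product, Finset.mem_filter, Finset.mem_Icc] at h
    omega
  have hmain : ∑ z ∈ B, w z * (((1 + z.1.1 * z.1.2) * (1 + z.2.1 * z.2.2) *
      z.1.2.lcm z.2.2 : ℕ) : ℝ)⁻¹ ≤
      2 / (M - 2 * L) * (1 + Real.log L₁) ^ 2 * (1 + Real.log L) ^ 2 := by
    calc _ ≤ ∑ z ∈ B, ((z.1.1 : ℝ) ^ 2 * (z.2.1 : ℝ) ^ 2 * (z.1.2 * z.2.2) *
          (z.1.2.lcm z.2.2 : ℕ))⁻¹ := by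
          refine Finset.sum_le_sum fun z hz => ?_
          obtain ⟨h1, h2, h3, h4⟩ := hpos z hz
          have h5 : 0 < z.1.2.lcm z.2.2 := Nat.lcm_pos h2 h4
          have h1' : (0 : ℝ) < z.1.1 := by exact_mod_cast h1
          have h2' : (0 : ℝ) < z.1.2 := by exact_mod_cast h2
          have h3' : (0 : ℝ) < z.2.1 := by exact_mod_cast h3
          have h4' : (0 : ℝ) < z.2.2 := by exact_mod_cast h4
          have h5' : (0 : ℝ) < (z.1.2.lcm z.2.2 : ℕ) := by exact_mod_cast h5
          simp only [w]
          rw [← mul_inv, ← mul_inv]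
          refine inv_anti₀ (by positivity) ?_
          push_cast
          calc _ = (z.1.1 : ℝ) * z.2.1 * ((z.1.1 * z.1.2) * (z.2.1 * z.2.2) *
                (z.1.2.lcm z.2.2 : ℕ)) := by ring
            _ ≤ _ := by
                gcongr
                · linarith
                · linarith
      _ ≤ 2 / (M - 2 * L) * (∑ d ∈ Finset.Icc 1 ⌊L₁⌋₊, (d : ℝ)⁻¹) ^ 2 *
          (∑ g ∈ Finset.Icc 1 ⌊L⌋₊, (g : ℝ)⁻¹) ^ 2 := by
          exact sum_inv_lcm_le hN B (hBA.trans hAF) fun z hz => (Finset.mem_filter.mp hz).2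
      _ ≤ _ := by
          have h0 : ∀ y : ℝ, 0 ≤ ∑ d ∈ Finset.Icc 1 ⌊y⌋₊, (d : ℝ)⁻¹ := fun y =>
            Finset.sum_nonneg fun _ _ => by positivity
          have h1 := h0 L₁
          have h2 := h0 L
          gcongr
          · exact sum_inv_le_one_add_log hL₁
          · exact sum_inv_le_one_add_log hL
  calc ∑ n ∈ S, (fermatCount n : ℝ) ≤ ∑ n ∈ S, x * w (t n) :=
        Finset.sum_le_sum fun n hn => (hdata n hn).2.2.2.2.2
    _ = ∑ z ∈ B, ∑ n ∈ S with t n = z, x * w (t n) :=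
        (Finset.sum_fiberwise_of_maps_to (fun n hn => (hdata n hn).2.2.2.2.1) _).symm
    _ ≤ ∑ z ∈ B, (x * w z + x ^ 2 * (w z * (((1 + z.1.1 * z.1.2) * (1 + z.2.1 * z.2.2) *
          z.1.2.lcm z.2.2 : ℕ) : ℝ)⁻¹)) := by
        refine Finset.sum_le_sum fun z _ => ?_
        have hcard := card_le_of_gcdPair_eq hx (s := S.filter fun n => t n = z)
          largestPrimeFactor secondPrimeFactor z fun n hn => by
            obtain ⟨hn, htz⟩ := Finset.mem_filter.mp hn
            obtain ⟨h1, h2, h3, h4, -, -⟩ := hdata n hn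
            exact ⟨h1, h2, h3, h4, htz⟩
        calc _ = ∑ n ∈ S with t n = z, x * w z := by
              refine Finset.sum_congr rfl fun n hn => ?_
              rw [(Finset.mem_filter.mp hn).2]
          _ = ((S.filter fun n => t n = z).card : ℝ) * (x * w z) := by
              rw [Finset.sum_const, nsmul_eq_mul]
          _ ≤ _ := mul_le_mul_of_nonneg_right hcard (mul_nonneg hx (hw z))
          _ = _ := by ring
    _ = x * ∑ z ∈ B, w z + x ^ 2 * ∑ z ∈ B, w z * (((1 + z.1.1 * z.1.2) * (1 + z.2.1 * z.2.2) *
          z.1.2.lcm z.2.2 : ℕ) : ℝ)⁻¹ := by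
        rw [Finset.sum_add_distrib, Finset.mul_sum, Finset.mul_sum]
    _ ≤ _ := by gcongr

/-! ### Comparison with the constant C -/

theorem bound_le_constC {x L₁ L M : ℝ} (hL₁ : 10 < L₁) (hL : L₁ < L) (hLM : L < M / 2)
    (hx : L ^ 2 < x) :
    x ^ 2 * (2 / M) + (x * ((7 / 4 * L) ^ 2 / 2) +
        x ^ 2 * (2 / (M - 2 * L) * (1 + Real.log L₁) ^ 2 * (1 + Real.log L) ^ 2)) ≤
      x ^ 2 * constC x L₁ L M := by
  have hx0 : 0 < x := by nlinarith
  have hN : 0 < M - 2 * L := by linarith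
  have hM : 0 < M := by linarith
  -- The threshold at which (7/4)²/2 ≤ (1 + log L₁)/2; log 8 already exceeds it.
  have hl : 33 / 16 ≤ Real.log L₁ := by
    have h8 : Real.log 8 = 3 * Real.log 2 := by
      rw [show (8 : ℝ) = 2 ^ 3 by norm_num, Real.log_pow]; norm_num
    have := Real.log_two_gt_d9
    have := Real.log_le_log (by norm_num) (show (8 : ℝ) ≤ L₁ by linarith)
    linarith
  have hΛ : Real.log L₁ ≤ Real.log L := Real.log_le_log (by linarith) hL.le
  have hlM : 0 < Real.log M := Real.log_pos (by linarith)
  have hz := one_sixth_le_zeta_three_sub_one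
  rw [constC]
  set l := Real.log L₁
  set Λ := Real.log L
  set ζ := (riemannZeta 3).re - 1
  have e1 : x * ((7 / 4 * L) ^ 2 / 2) ≤ x ^ 2 * (L ^ 2 / (2 * x) * (1 + l)) := by
    rw [show x ^ 2 * (L ^ 2 / (2 * x) * (1 + l)) = x * (L ^ 2 / 2 * (1 + l)) by field_simp]
    gcongr
    nlinarith [sq_nonneg L]
  -- The middle term of C is simply discarded: the contribution 2/M of the case Q = P is absorbed by
  -- the last term.
  have e2 : 0 ≤ 2 * (1 + l) ^ 2 / (M * Real.log M) := by positivity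
  have e3 : 2 / M ≤ 2 / (M - 2 * L) := by
    gcongr
    linarith
  have h4 : 144 * (1 + l) ^ 2 ≤ (4 + l) ^ 4 := by
    -- The difference of the two sides is (l-2)².
    have h : 12 * (1 + l) ≤ (4 + l) ^ 2 := by nlinarith [sq_nonneg (l - 2)]
    calc 144 * (1 + l) ^ 2 = (12 * (1 + l)) ^ 2 := by ring
      _ ≤ ((4 + l) ^ 2) ^ 2 := by gcongr
      _ = _ := by ring
  have h5 : 2 + 2 * (1 + l) ^ 2 * (1 + Λ) ^ 2 ≤
      1 / 12 * ((1 + Λ) * (4 + l) ^ 4 * (5 / 12 + ζ * (1 + Λ))) := by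
    have hΛ3 : 3 ≤ 1 + Λ := by linarith
    have hl3 : 9 ≤ (1 + l) ^ 2 := by nlinarith
    -- With ζ replaced by 1/6 the quadratic terms in 1 + Λ cancel, and the 5/12 leaves 5(1+l)²(1+Λ),
    -- ample to cover 2.
    calc 2 + 2 * (1 + l) ^ 2 * (1 + Λ) ^ 2
        ≤ 1 / 12 * ((1 + Λ) * (144 * (1 + l) ^ 2) * (5 / 12 + 1 / 6 * (1 + Λ))) := by
          nlinarith [mul_le_mul hΛ3 hl3 (by norm_num) (by linarith)]
      _ ≤ _ := by gcongr
  have e4 : 2 / (M - 2 * L) + 2 / (M - 2 * L) * (1 + l) ^ 2 * (1 + Λ) ^ 2 ≤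
      1 / (12 * (M - 2 * L)) * (1 + Λ) * (4 + l) ^ 4 * (5 / 12 + ζ * (1 + Λ)) := by
    calc _ = (2 + 2 * (1 + l) ^ 2 * (1 + Λ) ^ 2) / (M - 2 * L) := by ring
      _ ≤ (1 / 12 * ((1 + Λ) * (4 + l) ^ 4 * (5 / 12 + ζ * (1 + Λ)))) / (M - 2 * L) := by gcongr
      _ = _ := by field_simp
  have hxx : 0 ≤ x ^ 2 := sq_nonneg x
  have := mul_le_mul_of_nonneg_left e4 hxx
  have := mul_le_mul_of_nonneg_left e3 hxx
  have := mul_nonneg hxx e2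
  linarith

theorem mainTheorem8 (x L₁ L M : ℝ) (hL₁ : 10 < L₁) (hL : L₁ < L) (hLM : L < M / 2)
    (hML : M < L ^ 2) (hx : L ^ 2 < x) :
    ∑ n ∈ smoothNearCarmichael x L₁ L M, (fermatCount n : ℝ) ≤ x ^ 2 * constC x L₁ L M := by
  have hx0 : 0 ≤ x := (sq_nonneg L).trans hx.le
  rw [← Finset.sum_filter_add_sum_filter_not _
    (fun n => secondPrimeFactor n = largestPrimeFactor n)]
  exact (add_le_add (sum_fermatCount_of_eq_le hx0 (by linarith))
    (sum_fermatCount_of_ne_le hx0 (by linarith) (by linarith) (by linarith))).trans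
    (bound_le_constC hL₁ hL hLM hx)
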